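/- Let $r,s\ge 1$ and $n=r+s$, let $J=I_r\oplus(-I_s)$, and put $[x,y]_J=y^*Jx$ for $x,y\in\mathbb C^n$. For $A\in M_n(\mathbb C)$ the Krein space numerical range is $$W^J(A)=\{[Ax,x]_J:\ [x,x]_J=1\}\ \cup\ \{-[Ax,x]_J:\ [x,x]_J=-1\}.$$ For $f,g\in\mathbb C$ and $M>0$, a set $S\subseteq\mathbb C$ is called a non-degenerate hyperbolic disc with foci $f,g$ and non-transverse axis of length $M$ if there is $N>0$ (the length of the transverse axis) with $N^2+M^2=|f-g|^2$ and $$S=\{z\in\mathbb C:\ \bigl||z-f|-|z-g|\bigr|\ge N\},$$ i.e. $S$ consists of the hyperbola with these foci and axes together with the two convex regions bounded by its branches. Let $$A=\begin{bmatrix}\alpha I_r & C\\ O & \beta I_s\end{bmatrix},\qquad \alpha,\beta\in\mathbb C,\ \alpha\ne\beta,\quad C\in\mathbb C^{r\times s},\ C\neq O,$$ and let $\|C\|$ be the spectral norm of $C$. Then $W^J(A)$ is a non-degenerate hyperbolic disc with foci $\alpha$ and $\beta$ and non-transverse axis of length $\|C\|$ if and only if $\|C\|<|\alpha-\beta|$.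 Moreover, $W^J(A)$ is a non-degenerate hyperbolic disc (with any foci and any axes) only if $\|C\|<|\alpha-\beta|$. -/

import Mathlib

open scoped Matrix Matrix.Norms.L2Operator

/-- The indefinite inner product `[x, y]_H = y* H x` on `ℂⁿ`. -/
def indefInner {ι : Type*} [Fintype ι] (H : Matrix ι ι ℂ) (x y : ι → ℂ) : ℂ :=
  star y ⬝ᵥ (H *ᵥ x)

/-- `W_+^H(A) = {[Ax, x]_H : [x, x]_H = 1}`. -/
def kreinRangePos {ι : Type*} [Fintype ι] (H A : Matrix ι ι ℂ) : Set ℂ :=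
  {w | ∃ x : ι → ℂ, indefInner H x x = 1 ∧ w = indefInner H (A *ᵥ x) x}

/-- `W_-^H(A) = {[Ax, x]_H : [x, x]_H = -1}`. -/
def kreinRangeNeg {ι : Type*} [Fintype ι] (H A : Matrix ι ι ℂ) : Set ℂ :=
  {w | ∃ x : ι → ℂ, indefInner H x x = -1 ∧ w = indefInner H (A *ᵥ x) x}

/-- The Krein space numerical range `W^H(A) = -W_-^H(A) ∪ W_+^H(A)`. -/
def kreinRange {ι : Type*} [Fintype ι] (H A : Matrix ι ι ℂ) : Set ℂ :=
  {w | -w ∈ kreinRangeNeg H A} ∪ kreinRangePos H A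

/-- The inertia matrix `J = I_r ⊕ -I_s`. -/
def inertiaJ (r s : ℕ) : Matrix (Fin r ⊕ Fin s) (Fin r ⊕ Fin s) ℂ :=
  Matrix.fromBlocks 1 0 0 (-1)

/-- The set bounded by the hyperbola with foci `f`, `g` and transverse axis of length `N`,
`{z : | |z - f| - |z - g| | = N}`: the hyperbola itself together with the two convex regions
bounded by its branches (those containing the foci). -/
def hyperbolicRegion (f g : ℂ) (N : ℝ) : Set ℂ :=
  {z | N ≤ |‖z - f‖ - ‖z - g‖|}

/-- `S` is the non-degenerate hyperbolic disc with foci `f`, `g` and non-transverse axis of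
(full) length `M`. The transverse axis has the positive length `N` with `N² + M² = |f - g|²`
(for semi-axes `a = N / 2`, `b = M / 2` and focal distance `2 c = |f - g|`, this is
`a² + b² = c²`). -/
def IsNondegHyperbolicDisc (S : Set ℂ) (f g : ℂ) (M : ℝ) : Prop :=
  0 < M ∧ ∃ N : ℝ, 0 < N ∧ N ^ 2 + M ^ 2 = ‖f - g‖ ^ 2 ∧ S = hyperbolicRegion f g N

/-!
The set `W^J(A)` is a union of circles. For `x = (u, v)`, the value of `±[Ax, x]_J` at a vector
with `[x, x]_J = ±1` depends only on `p = ±(‖u‖² + ‖v‖²)` and on `⟪u, C v⟫`, a complex number of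
modulus at most `‖C‖ ‖u‖ ‖v‖ = ‖C‖ √(p² - 1) / 2`. All numbers of exactly this modulus occur,
because the operator norm of `C` is attained. With `α = m + δ`, `β = m - δ` and `ζ = z - m`,

* `z ∈ W^J(A)` implies `‖ζ - p δ‖² ≤ (p² - 1) ‖C‖² / 4` for some real `p`,
* equality for some real `p` implies `z ∈ W^J(A)`

(`exists_norm_sub_sq_le_of_mem_kreinRange`, `mem_kreinRange_of_norm_sub_sq_eq`). The difference of
the two sides is a real polynomial of degree at most two in `p`, with leading coefficient
`‖δ‖² - ‖C‖² / 4`.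

If `‖C‖ < ‖α - β‖ = 2 ‖δ‖`, this coefficient is positive, so that the inequality is solvable iff
the equation is, iff the discriminant is nonnegative. This discriminant condition on `ζ` describes
the hyperbolic region (`mem_hyperbolicRegion_add_sub_iff`), by the factorization of
`N⁴ - 2 N² (X² + Y²) + (X² - Y²)²` as `(N² - (X - Y)²) (N² - (X + Y)²)` in the two focal
distances `X`, `Y`, whose second factor is negative by the triangle inequality.

If `‖C‖ ≥ ‖α - β‖`, the equation is solvable for all `ζ` off the line orthogonal to `δ`, so
`W^J(A)` is dense in the plane. A hyperbolic region is closed and omits the midpoint of its foci, so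
it is not dense.
-/

open scoped ComplexConjugate

/-! ### Points of the Krein space numerical range -/

/-- The operator between Euclidean spaces defined by a matrix. Its operator norm is by definition
the spectral norm of the matrix. -/
noncomputable def matrixCLM {r s : ℕ} (C : Matrix (Fin r) (Fin s) ℂ) :
    EuclideanSpace ℂ (Fin s) →L[ℂ] EuclideanSpace ℂ (Fin r) :=
  (Matrix.toEuclideanLin ≪≫ₗ LinearMap.toContinuousLinearMap) C

lemma norm_matrixCLM {r s : ℕ} (C : Matrix (Fin r) (Fin s) ℂ) : ‖matrixCLM C‖ = ‖C‖ := rfl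

lemma star_dotProduct_self_eq_norm_sq {n : ℕ} (u : EuclideanSpace ℂ (Fin n)) :
    star u.ofLp ⬝ᵥ u.ofLp = ((‖u‖ ^ 2 : ℝ) : ℂ) := by
  rw [dotProduct_comm, ← EuclideanSpace.inner_eq_star_dotProduct, inner_self_eq_norm_sq_to_K]
  simp

lemma star_dotProduct_mulVec_eq_inner {r s : ℕ} (C : Matrix (Fin r) (Fin s) ℂ)
    (u : EuclideanSpace ℂ (Fin r)) (v : EuclideanSpace ℂ (Fin s)) :
    star u.ofLp ⬝ᵥ (C *ᵥ v.ofLp) = inner ℂ u (matrixCLM C v) := by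
  rw [EuclideanSpace.inner_eq_star_dotProduct, dotProduct_comm]
  rfl

lemma star_sumElim {r s : ℕ} (u : Fin r → ℂ) (v : Fin s → ℂ) :
    star (Sum.elim u v) = Sum.elim (star u) (star v) := by
  ext i; cases i <;> rfl

lemma indefInner_inertiaJ_self {r s : ℕ}
    (u : EuclideanSpace ℂ (Fin r)) (v : EuclideanSpace ℂ (Fin s)) :
    indefInner (inertiaJ r s) (Sum.elim u.ofLp v.ofLp) (Sum.elim u.ofLp v.ofLp) =
      ((‖u‖ ^ 2 - ‖v‖ ^ 2 : ℝ) : ℂ) := by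
  rw [indefInner, inertiaJ, Matrix.fromBlocks_mulVec, star_sumElim, sumElim_dotProduct_sumElim]
  simp only [Sum.elim_comp_inl, Sum.elim_comp_inr, Matrix.one_mulVec, Matrix.zero_mulVec, add_zero,
    zero_add, Matrix.neg_mulVec, dotProduct_neg, star_dotProduct_self_eq_norm_sq]
  push_cast
  ring

lemma indefInner_inertiaJ_fromBlocks {r s : ℕ} (α β : ℂ) (C : Matrix (Fin r) (Fin s) ℂ)
    (u : EuclideanSpace ℂ (Fin r)) (v : EuclideanSpace ℂ (Fin s)) :
    indefInner (inertiaJ r s)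
        (Matrix.fromBlocks (α • 1) C 0 (β • 1) *ᵥ Sum.elim u.ofLp v.ofLp) (Sum.elim u.ofLp v.ofLp) =
      α * (‖u‖ ^ 2 : ℝ) - β * (‖v‖ ^ 2 : ℝ) + inner ℂ u (matrixCLM C v) := by
  rw [indefInner, inertiaJ, Matrix.fromBlocks_mulVec, Matrix.fromBlocks_mulVec, star_sumElim,
    sumElim_dotProduct_sumElim]
  simp only [Sum.elim_comp_inl, Sum.elim_comp_inr, Matrix.one_mulVec, Matrix.zero_mulVec, add_zero,
    zero_add, Matrix.neg_mulVec, dotProduct_neg, Matrix.smul_mulVec, dotProduct_add,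
    dotProduct_smul, star_dotProduct_self_eq_norm_sq, star_dotProduct_mulVec_eq_inner, smul_eq_mul]
  ring

lemma mem_kreinRange_iff {r s : ℕ} (α β : ℂ) (C : Matrix (Fin r) (Fin s) ℂ) (z : ℂ) :
    z ∈ kreinRange (inertiaJ r s) (Matrix.fromBlocks (α • 1) C 0 (β • 1)) ↔
      ∃ (u : EuclideanSpace ℂ (Fin r)) (v : EuclideanSpace ℂ (Fin s)),
        (‖v‖ ^ 2 - ‖u‖ ^ 2 = 1 ∧
          z = β * (‖v‖ ^ 2 : ℝ) - α * (‖u‖ ^ 2 : ℝ) - inner ℂ u (matrixCLM C v)) ∨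
        (‖u‖ ^ 2 - ‖v‖ ^ 2 = 1 ∧
          z = α * (‖u‖ ^ 2 : ℝ) - β * (‖v‖ ^ 2 : ℝ) + inner ℂ u (matrixCLM C v)) := by
  constructor
  · rintro (⟨x, hx, hz⟩ | ⟨x, hx, hz⟩)
    all_goals
      obtain ⟨u, v, rfl⟩ : ∃ (u : EuclideanSpace ℂ (Fin r)) (v : EuclideanSpace ℂ (Fin s)),
          x = Sum.elim u.ofLp v.ofLp :=
        ⟨WithLp.toLp 2 (x ∘ Sum.inl), WithLp.toLp 2 (x ∘ Sum.inr), (Sum.elim_comp_inl_inr x).symm⟩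
      rw [indefInner_inertiaJ_self] at hx
      rw [indefInner_inertiaJ_fromBlocks] at hz
    · refine ⟨u, v, Or.inl ⟨?_, by linear_combination -hz⟩⟩
      have : ‖u‖ ^ 2 - ‖v‖ ^ 2 = -1 := by exact_mod_cast hx
      linarith
    · exact ⟨u, v, Or.inr ⟨by exact_mod_cast hx, hz⟩⟩
  · rintro ⟨u, v, ⟨h, hz⟩ | ⟨h, hz⟩⟩
    · refine Or.inl ⟨Sum.elim u.ofLp v.ofLp, ?_, ?_⟩
      · rw [indefInner_inertiaJ_self, show ‖u‖ ^ 2 - ‖v‖ ^ 2 = -1 by linarith]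
        simp
      · rw [indefInner_inertiaJ_fromBlocks, hz]
        ring
    · refine Or.inr ⟨Sum.elim u.ofLp v.ofLp, ?_, ?_⟩
      · rw [indefInner_inertiaJ_self, h]
        simp
      · rw [indefInner_inertiaJ_fromBlocks, hz]

/-! ### The numerical range as a union of circles -/

/-- In finite dimension the operator norm is attained, so the sesquilinear form of `T` takes every
value of the extremal modulus on vectors of prescribed norms. -/
lemma exists_inner_apply_eq {E F : Type*} [NormedAddCommGroup E] [InnerProductSpace ℂ E]
    [FiniteDimensional ℂ E] [NormedAddCommGroup F] [InnerProductSpace ℂ F]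
    {T : E →L[ℂ] F} (hT : T ≠ 0) {a b : ℝ} (ha : 0 ≤ a) (hb : 0 ≤ b) {w : ℂ}
    (hw : ‖w‖ = a * b * ‖T‖) :
    ∃ (u : F) (v : E), ‖u‖ = a ∧ ‖v‖ = b ∧ inner ℂ u (T v) = w := by
  have : ProperSpace E := FiniteDimensional.proper ℂ E
  have : Nontrivial E := by
    by_contra h
    rw [not_nontrivial_iff_subsingleton] at h
    exact hT (Subsingleton.elim _ _)
  have hT0 : 0 < ‖T‖ := norm_pos_iff.2 hT
  obtain ⟨v₀, hv₀, hmax⟩ := (isCompact_sphere (0 : E) 1).exists_isMaxOn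
    (Set.nonempty_coe_sort.1 (NormedSpace.sphere_nonempty_rclike ℂ zero_le_one)) (f := fun v => ‖T v‖)
    T.continuous.norm.continuousOn
  have hv₀ : ‖v₀‖ = 1 := by simpa using hv₀
  have hTv : ‖T v₀‖ = ‖T‖ := by
    refine le_antisymm (by simpa [hv₀] using T.le_opNorm v₀) ?_
    exact T.opNorm_le_of_unit_norm (norm_nonneg _) fun x hx => hmax (by simpa using hx)
  obtain ⟨c, hc, hwc⟩ : ∃ c : ℂ, ‖c‖ = 1 ∧ w = ‖w‖ * c :=
    ⟨Complex.exp (w.arg * Complex.I), Complex.norm_exp_ofReal_mul_I _,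
      (Complex.norm_mul_exp_arg_mul_I w).symm⟩
  refine ⟨((a / ‖T‖ : ℝ) : ℂ) • T v₀, ((b : ℂ) * c) • v₀, ?_, ?_, ?_⟩
  · rw [norm_smul, hTv, Complex.norm_real, Real.norm_of_nonneg (by positivity)]
    field_simp
  · rw [norm_smul, norm_mul, hc, hv₀, Complex.norm_real, Real.norm_of_nonneg hb]
    ring
  · have h0 : (‖T‖ : ℂ) ≠ 0 := by exact_mod_cast hT0.ne'
    rw [map_smul, inner_smul_left, inner_smul_right, inner_self_eq_norm_sq_to_K, hTv,
      Complex.conj_ofReal, hwc, hw]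
    simp only [Complex.coe_algebraMap]
    push_cast
    field_simp

lemma exists_norm_sub_sq_le_of_mem_kreinRange {r s : ℕ} (m δ : ℂ) (C : Matrix (Fin r) (Fin s) ℂ)
    {z : ℂ} (hz : z ∈ kreinRange (inertiaJ r s)
      (Matrix.fromBlocks ((m + δ) • 1) C 0 ((m - δ) • 1))) :
    ∃ p : ℝ, ‖z - m - p * δ‖ ^ 2 ≤ (p ^ 2 - 1) * (‖C‖ ^ 2 / 4) := by
  obtain ⟨u, v, h⟩ := (mem_kreinRange_iff _ _ _ _).1 hz
  have hi : ‖inner ℂ u (matrixCLM C v)‖ ^ 2 ≤ ‖u‖ ^ 2 * ‖v‖ ^ 2 * ‖C‖ ^ 2 := by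
    rw [← mul_pow, ← mul_pow]
    gcongr
    calc ‖inner ℂ u (matrixCLM C v)‖ ≤ ‖u‖ * ‖matrixCLM C v‖ := norm_inner_le_norm _ _
      _ ≤ ‖u‖ * (‖matrixCLM C‖ * ‖v‖) := by gcongr; exact (matrixCLM C).le_opNorm v
      _ = ‖u‖ * ‖v‖ * ‖C‖ := by rw [norm_matrixCLM]; ring
  rcases h with ⟨h, hz⟩ | ⟨h, hz⟩
  · refine ⟨-(‖u‖ ^ 2 + ‖v‖ ^ 2), ?_⟩
    have h' : ((‖v‖ ^ 2 : ℝ) : ℂ) = 1 + (‖u‖ ^ 2 : ℝ) := by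
      rw [show ‖v‖ ^ 2 = 1 + ‖u‖ ^ 2 by linarith]; push_cast; ring
    have : z - m - (-(‖u‖ ^ 2 + ‖v‖ ^ 2) : ℝ) * δ = -inner ℂ u (matrixCLM C v) := by
      rw [hz]; push_cast at h' ⊢; linear_combination m * h'
    rw [this, norm_neg]
    convert hi using 1
    rw [show ‖v‖ ^ 2 = 1 + ‖u‖ ^ 2 by linarith]
    ring
  · refine ⟨‖u‖ ^ 2 + ‖v‖ ^ 2, ?_⟩
    have h' : ((‖u‖ ^ 2 : ℝ) : ℂ) = 1 + (‖v‖ ^ 2 : ℝ) := by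
      rw [show ‖u‖ ^ 2 = 1 + ‖v‖ ^ 2 by linarith]; push_cast; ring
    have : z - m - (‖u‖ ^ 2 + ‖v‖ ^ 2 : ℝ) * δ = inner ℂ u (matrixCLM C v) := by
      rw [hz]; push_cast at h' ⊢; linear_combination m * h'
    rw [this]
    convert hi using 1
    rw [show ‖u‖ ^ 2 = 1 + ‖v‖ ^ 2 by linarith]
    ring

lemma mem_kreinRange_of_norm_sub_sq_eq {r s : ℕ} (m δ : ℂ) {C : Matrix (Fin r) (Fin s) ℂ}
    (hC : C ≠ 0) {z : ℂ} {p : ℝ} (hp : ‖z - m - p * δ‖ ^ 2 = (p ^ 2 - 1) * (‖C‖ ^ 2 / 4)) :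
    z ∈ kreinRange (inertiaJ r s) (Matrix.fromBlocks ((m + δ) • 1) C 0 ((m - δ) • 1)) := by
  have hC0 : 0 < ‖C‖ := norm_pos_iff.2 hC
  have hT : matrixCLM C ≠ 0 := by rwa [← norm_pos_iff, norm_matrixCLM]
  have hp1 : 1 ≤ p ^ 2 := by
    have := nonneg_of_mul_nonneg_left (hp ▸ sq_nonneg _) (by positivity : 0 < ‖C‖ ^ 2 / 4)
    linarith
  rw [mem_kreinRange_iff]
  rcases le_abs'.1 ((one_le_sq_iff_one_le_abs p).1 hp1) with h | h
  · obtain ⟨u, v, hu, hv, hi⟩ := exists_inner_apply_eq hT (Real.sqrt_nonneg ((-p - 1) / 2))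
      (Real.sqrt_nonneg ((-p + 1) / 2)) (w := -(z - m - p * δ)) (by
        rw [norm_neg, norm_matrixCLM, ← sq_eq_sq₀ (norm_nonneg _) (by positivity), hp, mul_pow,
          mul_pow, Real.sq_sqrt (by linarith), Real.sq_sqrt (by linarith)]
        ring)
    refine ⟨u, v, Or.inl ?_⟩
    rw [hi, hu, hv, Real.sq_sqrt (by linarith), Real.sq_sqrt (by linarith)]
    refine ⟨by ring, ?_⟩
    push_cast
    ring
  · obtain ⟨u, v, hu, hv, hi⟩ := exists_inner_apply_eq hT (Real.sqrt_nonneg ((p + 1) / 2))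
      (Real.sqrt_nonneg ((p - 1) / 2)) (w := z - m - p * δ) (by
        rw [norm_matrixCLM, ← sq_eq_sq₀ (norm_nonneg _) (by positivity), hp, mul_pow,
          mul_pow, Real.sq_sqrt (by linarith), Real.sq_sqrt (by linarith)]
        ring)
    refine ⟨u, v, Or.inr ?_⟩
    rw [hi, hu, hv, Real.sq_sqrt (by linarith), Real.sq_sqrt (by linarith)]
    refine ⟨by ring, ?_⟩
    push_cast
    ring

/-! ### The quadratic equation for the circle parameter -/

lemma norm_sub_ofReal_mul_sq (ζ δ : ℂ) (p : ℝ) :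
    ‖ζ - p * δ‖ ^ 2 = ‖δ‖ ^ 2 * p ^ 2 - 2 * (ζ * conj δ).re * p + ‖ζ‖ ^ 2 := by
  simp only [Complex.sq_norm, Complex.normSq_apply, Complex.sub_re, Complex.sub_im, Complex.mul_re,
    Complex.mul_im, Complex.ofReal_re, Complex.ofReal_im, Complex.conj_re, Complex.conj_im]
  ring

/-- The necessary direction of the discriminant criterion, for a positive leading coefficient. -/
lemma mul_le_sq_of_norm_sub_sq_le {ζ δ : ℂ} {k p : ℝ} (hk : k < ‖δ‖ ^ 2)
    (h : ‖ζ - p * δ‖ ^ 2 ≤ (p ^ 2 - 1) * k) :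
    (‖δ‖ ^ 2 - k) * (‖ζ‖ ^ 2 + k) ≤ (ζ * conj δ).re ^ 2 := by
  rw [norm_sub_ofReal_mul_sq] at h
  nlinarith [sq_nonneg ((‖δ‖ ^ 2 - k) * p - (ζ * conj δ).re),
    mul_le_mul_of_nonneg_left h (sub_nonneg.2 hk.le)]

lemma exists_norm_sub_sq_eq_of_mul_le_sq {ζ δ : ℂ} {k : ℝ} (hk : k ≠ ‖δ‖ ^ 2)
    (h : (‖δ‖ ^ 2 - k) * (‖ζ‖ ^ 2 + k) ≤ (ζ * conj δ).re ^ 2) :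
    ∃ p : ℝ, ‖ζ - p * δ‖ ^ 2 = (p ^ 2 - 1) * k := by
  obtain ⟨p, hp⟩ := exists_quadratic_eq_zero (a := ‖δ‖ ^ 2 - k) (b := -2 * (ζ * conj δ).re)
    (c := ‖ζ‖ ^ 2 + k) (sub_ne_zero.2 hk.symm) ⟨_, (Real.mul_self_sqrt (by
      rw [discrim]; linarith)).symm⟩
  refine ⟨p, ?_⟩
  rw [norm_sub_ofReal_mul_sq]
  linarith

lemma exists_norm_sub_sq_eq_of_le {ζ δ : ℂ} {k : ℝ} (hk : ‖δ‖ ^ 2 ≤ k)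
    (hζ : (ζ * conj δ).re ≠ 0) :
    ∃ p : ℝ, ‖ζ - p * δ‖ ^ 2 = (p ^ 2 - 1) * k := by
  rcases hk.eq_or_lt with hk' | hk'
  · -- The quadratic terms cancel, which leaves a linear equation.
    refine ⟨(‖ζ‖ ^ 2 + k) / (2 * (ζ * conj δ).re), ?_⟩
    rw [norm_sub_ofReal_mul_sq, hk']
    field_simp
    ring
  · refine exists_norm_sub_sq_eq_of_mul_le_sq hk'.ne' ?_
    have : 0 ≤ (k - ‖δ‖ ^ 2) * (‖ζ‖ ^ 2 + k) :=
      mul_nonneg (by linarith) (by nlinarith [sq_nonneg ‖ζ‖, sq_nonneg ‖δ‖])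
    nlinarith [sq_nonneg (ζ * conj δ).re]

/-! ### Hyperbolic regions -/

/-- A description of the hyperbolic region in terms of squared distances only. -/
lemma mem_hyperbolicRegion_iff {f g : ℂ} {N : ℝ} (hN : 0 ≤ N) (hfg : N < ‖f - g‖) (z : ℂ) :
    z ∈ hyperbolicRegion f g N ↔
      N ^ 2 * (2 * (‖z - f‖ ^ 2 + ‖z - g‖ ^ 2) - N ^ 2) ≤ (‖z - f‖ ^ 2 - ‖z - g‖ ^ 2) ^ 2 := by
  have htri : ‖f - g‖ ≤ ‖z - f‖ + ‖z - g‖ := by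
    rw [norm_sub_rev z f]
    exact norm_sub_le_norm_sub_add_norm_sub f z g
  have hpos : 0 < (‖z - f‖ + ‖z - g‖) ^ 2 - N ^ 2 := by nlinarith
  have hfac : (‖z - f‖ ^ 2 - ‖z - g‖ ^ 2) ^ 2 -
      N ^ 2 * (2 * (‖z - f‖ ^ 2 + ‖z - g‖ ^ 2) - N ^ 2) =
      ((‖z - f‖ - ‖z - g‖) ^ 2 - N ^ 2) * ((‖z - f‖ + ‖z - g‖) ^ 2 - N ^ 2) := by ring
  rw [← sub_nonneg (b := N ^ 2 * _), hfac, mul_nonneg_iff_of_pos_right hpos, sub_nonneg,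
    sq_le_sq, abs_of_nonneg hN]
  rfl

/-- The same description relative to the centre `m` and the half focal vector `δ`. Its right side is
the discriminant condition for `k = ‖δ‖² - (N / 2)²`. -/
lemma mem_hyperbolicRegion_add_sub_iff {m δ : ℂ} {N k : ℝ} (hN : 0 ≤ N) (hk : 0 < k)
    (hNk : N ^ 2 + 4 * k = 4 * ‖δ‖ ^ 2) (z : ℂ) :
    z ∈ hyperbolicRegion (m + δ) (m - δ) N ↔
      (‖δ‖ ^ 2 - k) * (‖z - m‖ ^ 2 + k) ≤ ((z - m) * conj δ).re ^ 2 := by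
  have hd : ‖m + δ - (m - δ)‖ = 2 * ‖δ‖ := by
    rw [show m + δ - (m - δ) = 2 * δ by ring, norm_mul, Complex.norm_ofNat]
  rw [mem_hyperbolicRegion_iff hN (by rw [hd]; nlinarith [norm_nonneg δ])]
  have hf := norm_sub_ofReal_mul_sq (z - m) δ 1
  have hg := norm_sub_ofReal_mul_sq (z - m) δ (-1)
  rw [show z - m - ((1 : ℝ) : ℂ) * δ = z - (m + δ) by push_cast; ring] at hf
  rw [show z - m - ((-1 : ℝ) : ℂ) * δ = z - (m - δ) by push_cast; ring] at hg
  rw [hf, hg, show N ^ 2 = 4 * (‖δ‖ ^ 2 - k) by linarith]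
  constructor <;> intro h <;> linarith

lemma isClosed_hyperbolicRegion (f g : ℂ) (N : ℝ) : IsClosed (hyperbolicRegion f g N) :=
  isClosed_le continuous_const (by fun_prop)

lemma midpoint_notMem_hyperbolicRegion (f g : ℂ) {N : ℝ} (hN : 0 < N) :
    (f + g) / 2 ∉ hyperbolicRegion f g N := by
  have : ‖(f + g) / 2 - f‖ = ‖(f + g) / 2 - g‖ := by
    rw [← norm_neg]
    congr 1
    ring
  simp [hyperbolicRegion, this, hN]

/-! ### The two cases -/

lemma isNondegHyperbolicDisc_kreinRange {r s : ℕ} (m δ : ℂ) {C : Matrix (Fin r) (Fin s) ℂ}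
    (hC : C ≠ 0) (h : ‖C‖ < 2 * ‖δ‖) :
    IsNondegHyperbolicDisc
      (kreinRange (inertiaJ r s) (Matrix.fromBlocks ((m + δ) • 1) C 0 ((m - δ) • 1)))
      (m + δ) (m - δ) ‖C‖ := by
  have hC0 : 0 < ‖C‖ := norm_pos_iff.2 hC
  have hpos : 0 < (2 * ‖δ‖) ^ 2 - ‖C‖ ^ 2 := by nlinarith
  have hsq := Real.sq_sqrt hpos.le
  have hk : ‖C‖ ^ 2 / 4 < ‖δ‖ ^ 2 := by linarith
  refine ⟨hC0, √((2 * ‖δ‖) ^ 2 - ‖C‖ ^ 2), Real.sqrt_pos.2 hpos, ?_, ?_⟩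
  · rw [show m + δ - (m - δ) = 2 * δ by ring, norm_mul, Complex.norm_ofNat, hsq]
    ring
  · ext z
    rw [mem_hyperbolicRegion_add_sub_iff (k := ‖C‖ ^ 2 / 4) (Real.sqrt_nonneg _) (by positivity)
      (by rw [hsq]; ring)]
    constructor
    · intro hz
      obtain ⟨p, hp⟩ := exists_norm_sub_sq_le_of_mem_kreinRange m δ C hz
      exact mul_le_sq_of_norm_sub_sq_le hk hp
    · intro hz
      obtain ⟨p, hp⟩ := exists_norm_sub_sq_eq_of_mul_le_sq hk.ne hz
      exact mem_kreinRange_of_norm_sub_sq_eq m δ hC hp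

lemma dense_kreinRange {r s : ℕ} (m : ℂ) {δ : ℂ} (hδ : δ ≠ 0) {C : Matrix (Fin r) (Fin s) ℂ}
    (hC : C ≠ 0) (h : 2 * ‖δ‖ ≤ ‖C‖) :
    Dense (kreinRange (inertiaJ r s) (Matrix.fromBlocks ((m + δ) • 1) C 0 ((m - δ) • 1))) := by
  have hk : ‖δ‖ ^ 2 ≤ ‖C‖ ^ 2 / 4 := by nlinarith [norm_nonneg δ]
  have hδ0 : ‖δ‖ ^ 2 ≠ 0 := by simpa using hδ
  intro z
  set R := ((z - m) * conj δ).re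
  -- On the line `t ↦ z + t δ` the condition `Re ((z + t δ - m) conj δ) ≠ 0` fails for one `t` only.
  have hmem : ∀ t ∈ ({-R / ‖δ‖ ^ 2}ᶜ : Set ℝ), z + t * δ ∈ closure
      (kreinRange (inertiaJ r s) (Matrix.fromBlocks ((m + δ) • 1) C 0 ((m - δ) • 1))) := by
    intro t ht
    have hre : ((z + t * δ - m) * conj δ).re = R + t * ‖δ‖ ^ 2 := by
      rw [show (z + t * δ - m) * conj δ = (z - m) * conj δ + t * (δ * conj δ) by ring,
        Complex.mul_conj, ← Complex.ofReal_mul, Complex.add_re, Complex.ofReal_re, Complex.sq_norm]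
    obtain ⟨p, hp⟩ := exists_norm_sub_sq_eq_of_le (ζ := z + t * δ - m) hk (by
      rw [hre]
      intro h0
      refine ht ?_
      rw [Set.mem_singleton_iff, eq_div_iff hδ0]
      linarith)
    exact subset_closure (mem_kreinRange_of_norm_sub_sq_eq m δ hC hp)
  have hcl := isClosed_closure.preimage (f := fun t : ℝ => z + t * δ) (by fun_prop)
    |>.closure_subset_iff.2 hmem
  rw [(dense_compl_singleton (-R / ‖δ‖ ^ 2)).closure_eq] at hcl
  simpa using hcl (Set.mem_univ (0 : ℝ))

theorem mainTheorem8 (r s : ℕ) (α β : ℂ) (hαβ : α ≠ β)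
    (C : Matrix (Fin r) (Fin s) ℂ) (hC : C ≠ 0) :
    (IsNondegHyperbolicDisc
        (kreinRange (inertiaJ r s) (Matrix.fromBlocks (α • 1) C 0 (β • 1))) α β ‖C‖ ↔
      ‖C‖ < ‖α - β‖) ∧
    ((∃ (f g : ℂ) (M : ℝ), IsNondegHyperbolicDisc
        (kreinRange (inertiaJ r s) (Matrix.fromBlocks (α • 1) C 0 (β • 1))) f g M) ↔
      ‖C‖ < ‖α - β‖) := by
  obtain ⟨m, δ, rfl, rfl⟩ : ∃ m δ : ℂ, α = m + δ ∧ β = m - δ :=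
    ⟨(α + β) / 2, (α - β) / 2, by ring, by ring⟩
  have hδ : δ ≠ 0 := by
    rintro rfl
    simp at hαβ
  rw [show m + δ - (m - δ) = 2 * δ by ring, norm_mul, Complex.norm_ofNat]
  have hif := isNondegHyperbolicDisc_kreinRange m δ hC
  have honly : (∃ (f g : ℂ) (M : ℝ), IsNondegHyperbolicDisc (kreinRange (inertiaJ r s)
      (Matrix.fromBlocks ((m + δ) • 1) C 0 ((m - δ) • 1))) f g M) → ‖C‖ < 2 * ‖δ‖ := by
    rintro ⟨f, g, M, -, N, hN, -, hW⟩
    by_contra! hle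
    have hdense := dense_kreinRange m hδ hC hle
    rw [hW] at hdense
    refine midpoint_notMem_hyperbolicRegion f g hN ?_
    rw [← (isClosed_hyperbolicRegion f g N).closure_eq]
    exact hdense _
  exact ⟨⟨fun h => honly ⟨_, _, _, h⟩, hif⟩, ⟨honly, fun h => ⟨_, _, _, hif h⟩⟩⟩
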